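/- Let $K$ be an algebraically closed field of characteristic zero and let $L$ be a finite-dimensional Lie algebra over $K$ of the form $L=(L_0\oplus I)\ltimes J$; that is, $L=L_0\oplus I\oplus J$ as a vector space, where $L_0$ and $I$ are Lie subalgebras with $[L_0,I]=0$ and $J$ is an abelian ideal. Suppose that $L_0$ is semisimple, that $I$ is one-dimensional, that $J$ is an irreducible $L_0$-module (under the bracket of $L$), and that there is an element $e\in I$ which acts on $J$ as the identity, i.e. $[e,j]=j$ for all $j\in J$. Then $L$ is wild. Here $L$ is called wild if there is a $U(L)$-$K\langle x,y\rangle$-bimodule $P$, free of finite rank as a right module over the free associative algebra $K\langle x,y\rangle$, such that the functor $V\mapsto P\otimes_{K\langle x,y\rangle}V$ from finite-dimensional $K\langle x,y\rangle$-modules (pairs of operators on a finite-dimensional vector space, up to simultaneous similarity) to finite-dimensional representations of $L$ sends indecomposable modules to indecomposable representations and non-isomorphic modules to non-isomorphic representations. -/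

import Mathlib

namespace LieWild

universe u v w

attribute [local instance 100] LieRing.ofAssociativeRing

/-- A vector space `W` with a family of operators `φ s` (for instance a representation of a Lie
algebra, or a pair of operators, that is, a module over the free algebra on two generators) is
indecomposable if `W ≠ 0` and `W` is not the direct sum of two nonzero invariant subspaces. -/
def Indecomposable {K : Type u} [Field K] {S : Type w} {W : Type v} [AddCommGroup W] [Module K W]
    (φ : S → Module.End K W) : Prop :=
  Nontrivial W ∧ ∀ p q : Submodule K W,
    (∀ s, ∀ m ∈ p, φ s m ∈ p) → (∀ s, ∀ m ∈ q, φ s m ∈ q) → IsCompl p q → p = ⊥ ∨ q = ⊥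

/-- Two vector spaces with families of operators indexed by the same set are isomorphic if a linear
isomorphism intertwines the operators. -/
def Isomorphic {K : Type u} [Field K] {S : Type w} {W W' : Type v}
    [AddCommGroup W] [Module K W] [AddCommGroup W'] [Module K W']
    (φ : S → Module.End K W) (ψ : S → Module.End K W') : Prop :=
  ∃ e : W ≃ₗ[K] W', ∀ s m, e (φ s m) = ψ s (e m)

/-- Let `ρ` be a homomorphism from the Lie algebra `L` to the `n × n` matrices over the free algebra
`K⟨x₀, x₁⟩`; this is the same as a `U(L)`-`K⟨x₀, x₁⟩`-bimodule that is free of rank `n` as a right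
module, with a chosen basis. For a `K⟨x₀, x₁⟩`-module `V`, given by the pair of operators
`T 0`, `T 1`, the tensor product of the bimodule with `V` is the representation of `L` on `Vⁿ`
by the matrices `ρ x` with `T 0`, `T 1` substituted for the generators. -/
noncomputable def substRep {K : Type u} [Field K] {L : Type v} [LieRing L] [LieAlgebra K L] {n : ℕ}
    (ρ : L →ₗ⁅K⁆ Matrix (Fin n) (Fin n) (FreeAlgebra K (Fin 2)))
    {V : Type w} [AddCommGroup V] [Module K V] (T : Fin 2 → Module.End K V) :
    L →ₗ⁅K⁆ Module.End K (Fin n → V) :=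
  (((endVecAlgEquivMatrixEnd (Fin n) K K V).symm.toAlgHom.comp
    (FreeAlgebra.lift K T).mapMatrix).toLieHom).comp ρ

theorem substRep_apply {K : Type u} [Field K] {L : Type v} [LieRing L] [LieAlgebra K L] {n : ℕ}
    (ρ : L →ₗ⁅K⁆ Matrix (Fin n) (Fin n) (FreeAlgebra K (Fin 2)))
    {V : Type w} [AddCommGroup V] [Module K V] (T : Fin 2 → Module.End K V)
    (x : L) (m : Fin n → V) (i : Fin n) :
    substRep ρ T x m i = ∑ j, FreeAlgebra.lift K T (ρ x i j) (m j) := by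
  rfl

/-- The Lie algebra `L` over `K` is wild: there is a `U(L)`-`K⟨x₀, x₁⟩`-bimodule, free of finite
rank over `K⟨x₀, x₁⟩`, such that tensoring with it, a `K`-linear exact functor from
finite-dimensional `K⟨x₀, x₁⟩`-modules to finite-dimensional representations of `L`, preserves
indecomposability and reflects isomorphism. -/
def IsWild (K : Type u) [Field K] (L : Type v) [LieRing L] [LieAlgebra K L] : Prop :=
  ∃ (n : ℕ) (ρ : L →ₗ⁅K⁆ Matrix (Fin n) (Fin n) (FreeAlgebra K (Fin 2))),
    (∀ (V : Type u) [AddCommGroup V] [Module K V] [FiniteDimensional K V]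
      (T : Fin 2 → Module.End K V), Indecomposable T → Indecomposable (substRep ρ T)) ∧
    (∀ (V V' : Type u) [AddCommGroup V] [Module K V] [FiniteDimensional K V]
      [AddCommGroup V'] [Module K V'] [FiniteDimensional K V']
      (T : Fin 2 → Module.End K V) (T' : Fin 2 → Module.End K V'),
      Isomorphic (substRep ρ T) (substRep ρ T') → Isomorphic T T')

end LieWild

/-! The representation attached to a pair of operators on `V` has two layers, `V^P` and `J ⊗ V^Q`.
On `V^P` an element `x` acts by `c x • N`, where `c` is the coordinate along `e`; on `J ⊗ V^Q` it
acts by its action on `J` plus `c x • N'`. The `J`-component `j` of `x` sends `w` in the first layer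
to `j ⊗ Φ w`. Here `N` and `N'` are nilpotent and `Φ * N = N' * Φ`; only `Φ` involves the pair
(`blockRep`).

The element `e` has eigenvalue 0 on the first layer and 1 on the second, so intertwiners are block
diagonal (`eq_zero_of_shift_sub`). Schur's lemma turns the second block into `1 ⊗ G`
(`exists_block_eq`). What remains is a pair `F`, `G` commuting with the nilpotents and compatible
with `Φ`.

The Jordan blocks of `N`, and likewise those of `N'`, are placed on strictly nested intervals. A
graded map between two different blocks of the same operator then has positive degree
(`eq_zero_of_commute`), so `F` and `G` are triangular. Their degree-zero part is a morphism of
representations of a bipartite quiver, and `coeff` forces it to be a single map `h` intertwining the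
two pairs (`exists_isTriangular`). Triangularity lets `h` detect both splittings and isomorphisms
(`isWild_of_triangular`). -/

namespace LieWild

universe u v

attribute [local instance 100] LieRing.ofAssociativeRing

/-! ### Block matrices of linear maps -/

section Entries

variable {K : Type*} [Field K] {ι κ μ : Type*} {V V' V'' : Type*}
  [AddCommGroup V] [Module K V] [AddCommGroup V'] [Module K V'] [AddCommGroup V''] [Module K V'']

/-- The block `V → V'` of a linear map `V^κ → V'^ι` in row `i` and column `j`. -/
def entry [DecidableEq κ] (f : (κ → V) →ₗ[K] (ι → V')) (i : ι) (j : κ) : V →ₗ[K] V' :=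
  LinearMap.proj i ∘ₗ f ∘ₗ LinearMap.single K (fun _ => V) j

theorem apply_eq_sum_entry [DecidableEq κ] [Fintype κ] (f : (κ → V) →ₗ[K] (ι → V'))
    (m : κ → V) (i : ι) : f m i = ∑ j, entry f i j (m j) := by
  conv_lhs => rw [← Finset.univ_sum_single m, map_sum, Finset.sum_apply]
  rfl

theorem eq_of_entry_eq [DecidableEq κ] [Fintype κ] {f g : (κ → V) →ₗ[K] (ι → V')}
    (h : ∀ i j, entry f i j = entry g i j) : f = g := by
  ext1 j
  ext v i
  exact LinearMap.congr_fun (h i j) v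

theorem entry_comp [DecidableEq κ] [DecidableEq μ] [Fintype κ]
    (f : (κ → V') →ₗ[K] (ι → V'')) (g : (μ → V) →ₗ[K] (κ → V')) (i : ι) (j : μ) :
    entry (f ∘ₗ g) i j = ∑ k, entry f i k ∘ₗ entry g k j := by
  ext v
  rw [LinearMap.sum_apply]
  exact apply_eq_sum_entry f _ i

theorem entry_id_self [DecidableEq κ] (i : κ) :
    entry (LinearMap.id : (κ → V) →ₗ[K] (κ → V)) i i = LinearMap.id := by
  ext v
  simp [entry]

theorem entry_substRep {L : Type*} [LieRing L] [LieAlgebra K L] {n : ℕ}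
    (ρ : L →ₗ⁅K⁆ Matrix (Fin n) (Fin n) (FreeAlgebra K (Fin 2)))
    (T : Fin 2 → Module.End K V) (x : L) (i j : Fin n) :
    entry (substRep ρ T x) i j = FreeAlgebra.lift K T (ρ x i j) := by
  ext v
  change substRep ρ T x (Pi.single j v) i = _
  rw [substRep_apply, Finset.sum_eq_single j]
  · simp
  · intro k _ hk
    simp [hk]
  · simp

end Entries

/-! ### Triangular intertwiners and the criterion for wildness -/

section Triangular

variable {K : Type*} [Field K] {ι : Type*} {V V' V'' : Type*}
  [AddCommGroup V] [Module K V] [AddCommGroup V'] [Module K V'] [AddCommGroup V''] [Module K V'']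

/-- The family of blocks `F` is triangular with respect to the degrees `r`, and all its diagonal
blocks are equal to `h`. -/
def IsTriangular (r : ι → ℕ) (F : ι → ι → V →ₗ[K] V') (h : V →ₗ[K] V') : Prop :=
  (∀ i, F i i = h) ∧ ∀ i j, i ≠ j → r i ≤ r j → F i j = 0

/-- For `k ≠ i` one of the two factors goes against the degree and vanishes, so diagonals multiply.
-/
theorem IsTriangular.sum_comp_diag [Fintype ι] {r : ι → ℕ} {F : ι → ι → V' →ₗ[K] V''}
    {G : ι → ι → V →ₗ[K] V'} {h : V' →ₗ[K] V''} {h' : V →ₗ[K] V'}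
    (hF : IsTriangular r F h) (hG : IsTriangular r G h') (i : ι) :
    ∑ k, F i k ∘ₗ G k i = h ∘ₗ h' := by
  rw [Finset.sum_eq_single i, hF.1, hG.1]
  · intro k _ hk
    rcases le_total (r i) (r k) with hr | hr
    · rw [hF.2 i k hk.symm hr, LinearMap.zero_comp]
    · rw [hG.2 k i hk hr, LinearMap.comp_zero]
  · simp

/-- A strictly triangular idempotent vanishes. -/
theorem IsTriangular.eq_zero_of_idempotent [Fintype ι] {r : ι → ℕ} {F : ι → ι → V →ₗ[K] V}
    (hF : IsTriangular r F 0) (hidem : ∀ i j, F i j = ∑ k, F i k ∘ₗ F k j) (i j : ι) :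
    F i j = 0 := by
  -- Induction on the drop in degree. A nonzero term `F i k ∘ₗ F k j` needs `r i > r k > r j`, so
  -- its factors have smaller drop. Truncated subtraction makes `d = 0` the case `r i ≤ r j`.
  have key : ∀ d i j, r i - r j ≤ d → F i j = 0 := by
    intro d
    induction d with
    | zero =>
      intro i j hd
      by_cases hij : i = j
      · rw [hij, hF.1]
      · exact hF.2 i j hij (by omega)
    | succ d ih =>
      intro i j hd
      rw [hidem]
      refine Finset.sum_eq_zero fun k _ => ?_
      by_cases hk : r j < r k
      · rw [ih i k (by omega), LinearMap.zero_comp]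
      · have : F k j = 0 := by
          by_cases hkj : k = j
          · rw [hkj, hF.1]
          · exact hF.2 k j hkj (by omega)
        rw [this, LinearMap.comp_zero]
  exact key _ i j le_rfl

end Triangular

/-- If all intertwiners between the representations obtained from `ρ` are triangular, with constant
diagonal blocks that intertwine the given pairs of operators, then the Lie algebra is wild. -/
theorem isWild_of_triangular {K : Type u} [Field K] {L : Type v} [LieRing L] [LieAlgebra K L]
    {ι : Type*} [Fintype ι] [DecidableEq ι] [Nonempty ι]
    (ρ : L →ₗ⁅K⁆ Matrix ι ι (FreeAlgebra K (Fin 2))) (r : ι → ℕ)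
    (H : ∀ (V V' : Type u) [AddCommGroup V] [Module K V] [AddCommGroup V'] [Module K V']
      (T : Fin 2 → Module.End K V) (T' : Fin 2 → Module.End K V') (F : ι → ι → V →ₗ[K] V'),
      (∀ x i j, ∑ k, F i k ∘ₗ FreeAlgebra.lift K T (ρ x k j) =
        ∑ k, FreeAlgebra.lift K T' (ρ x i k) ∘ₗ F k j) →
      ∃ h : V →ₗ[K] V', (∀ s m, h (T s m) = T' s (h m)) ∧ IsTriangular r F h) :
    IsWild K L := by
  obtain ⟨n, ⟨ε⟩⟩ := Finite.exists_equiv_fin ι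
  let σ : L →ₗ⁅K⁆ Matrix (Fin n) (Fin n) (FreeAlgebra K (Fin 2)) :=
    ((Matrix.reindexAlgEquiv K (FreeAlgebra K (Fin 2)) ε).toAlgHom.toLieHom).comp ρ
  have hσ : ∀ x i j, σ x (ε i) (ε j) = ρ x i j := by
    intro x i j
    change ρ x (ε.symm (ε i)) (ε.symm (ε j)) = _
    simp
  have H' : ∀ (V V' : Type u) [AddCommGroup V] [Module K V] [AddCommGroup V'] [Module K V']
      (T : Fin 2 → Module.End K V) (T' : Fin 2 → Module.End K V')
      (f : (Fin n → V) →ₗ[K] (Fin n → V')),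
      (∀ x m, f (substRep σ T x m) = substRep σ T' x (f m)) →
      ∃ h : V →ₗ[K] V', (∀ s m, h (T s m) = T' s (h m)) ∧
        IsTriangular (r ∘ ε.symm) (entry f) h := by
    intro V V' _ _ _ _ T T' f hf
    obtain ⟨h, hT, h1, h2⟩ := H V V' T T' (fun i j => entry f (ε i) (ε j)) (by
      intro x i j
      have h0 : f ∘ₗ substRep σ T x = substRep σ T' x ∘ₗ f := LinearMap.ext (hf x)
      have h1 := congrArg (fun g => entry g (ε i) (ε j)) h0
      simp only [entry_comp, entry_substRep] at h1
      rw [← ε.sum_comp, ← ε.sum_comp] at h1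
      simpa only [hσ] using h1)
    refine ⟨h, hT, fun i => ?_, fun i j hij hr => ?_⟩
    · simpa using h1 (ε.symm i)
    · simpa using h2 (ε.symm i) (ε.symm j) (by simpa using hij) hr
  have hn : Nonempty (Fin n) := ε.symm.nonempty
  refine ⟨n, σ, ?_, ?_⟩
  · intro V _ _ _ T hV
    obtain ⟨hnt, hV⟩ := hV
    refine ⟨inferInstance, fun p q hp hq hpq => ?_⟩
    have hinv : ∀ (a b : Submodule K (Fin n → V)) (hab : IsCompl a b),
        (∀ s, ∀ m ∈ a, substRep σ T s m ∈ a) → (∀ s, ∀ m ∈ b, substRep σ T s m ∈ b) →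
        ∀ x m, a.projection b hab (substRep σ T x m) =
          substRep σ T x (a.projection b hab m) := by
      intro a b hab ha hb x m
      obtain ⟨y, z, rfl⟩ : ∃ (y : a) (z : b), (y : Fin n → V) + z = m := by
        obtain ⟨y, hy, z, hz, h⟩ := Submodule.mem_sup.1
          (hab.sup_eq_top ▸ Submodule.mem_top : m ∈ a ⊔ b)
        exact ⟨⟨y, hy⟩, ⟨z, hz⟩, h⟩
      have h1 := Submodule.projection_apply_left hab ⟨_, ha x y y.2⟩
      have h2 := Submodule.projection_apply_right hab ⟨_, hb x z z.2⟩
      simp only at h1 h2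
      simp [map_add, h1, h2]
    have hzero : ∀ (a b : Submodule K (Fin n → V)) (hab : IsCompl a b),
        IsTriangular (r ∘ ε.symm) (entry (a.projection b hab)) 0 → a = ⊥ := by
      intro a b hab h
      have h0 : a.projection b hab = 0 := by
        apply eq_of_entry_eq
        intro i j
        rw [h.eq_zero_of_idempotent (fun i j => ?_) i j]
        · rfl
        · rw [← entry_comp]
          exact congrArg (fun g => entry g i j) (Submodule.isIdempotentElem_projection hab).symm
      rw [← Submodule.range_projection hab, h0, LinearMap.range_zero]
    obtain ⟨h, hT, htri⟩ := H' V V T T (p.projection q hpq) (hinv p q hpq hp hq)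
    -- The diagonal of the idempotent `p.projection q hpq` is an idempotent endomorphism of the pair
    -- `T`, so indecomposability leaves only `h = 0` and `h = 1`.
    have hidem : h ∘ₗ h = h := by
      obtain ⟨i⟩ := hn
      rw [← htri.sum_comp_diag htri i, ← entry_comp, ← htri.1 i]
      exact congrArg (fun g => entry g i i) (Submodule.isIdempotentElem_projection hpq)
    have hidem' : ∀ m, h (h m) = h m := LinearMap.congr_fun hidem
    have hcompl : IsCompl (LinearMap.range h) (LinearMap.ker h) :=
      LinearMap.IsIdempotentElem.isCompl (f := h) hidem
    rcases hV (LinearMap.range h) (LinearMap.ker h) (by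
        rintro s _ ⟨m, rfl⟩
        exact ⟨T s m, hT s m⟩) (by
        intro s m hm
        rw [LinearMap.mem_ker] at hm ⊢
        rw [hT, hm, map_zero]) hcompl with h0 | h0
    · left
      rw [LinearMap.range_eq_bot] at h0
      subst h0
      exact hzero p q hpq htri
    · right
      have h1 : h = LinearMap.id := by
        ext m
        exact LinearMap.ker_eq_bot.1 h0 (hidem' m)
      subst h1
      -- The complementary projection has zero diagonal, so the first case applies with `p` and `q`
      -- exchanged.
      refine hzero q p hpq.symm ⟨fun i => ?_, fun i j hij hr => ?_⟩
      all_goals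
        have hsum : q.projection p hpq.symm = LinearMap.id - p.projection q hpq := by
          rw [← Submodule.projection_add_projection_eq_id hpq]
          abel
        rw [hsum]
      · change entry LinearMap.id i i - entry (p.projection q hpq) i i = 0
        rw [htri.1 i, entry_id_self, sub_self]
      · change entry LinearMap.id i j - entry (p.projection q hpq) i j = 0
        rw [htri.2 i j hij hr, sub_zero]
        ext v
        simp [entry, hij]
  · rintro V V' _ _ _ _ _ _ T T' ⟨f, hf⟩
    obtain ⟨h, hT, htri⟩ := H' V V' T T' f.toLinearMap hf
    obtain ⟨h', -, htri'⟩ := H' V' V T' T f.symm.toLinearMap (by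
      intro x m
      apply f.injective
      simp [hf])
    obtain ⟨i⟩ := hn
    have e1 : h ∘ₗ h' = LinearMap.id := by
      rw [← htri.sum_comp_diag htri' i, ← entry_comp, ← entry_id_self i]
      congr 1
      ext1 m
      simp
    have e2 : h' ∘ₗ h = LinearMap.id := by
      rw [← htri'.sum_comp_diag htri i, ← entry_comp, ← entry_id_self i]
      congr 1
      ext1 m
      simp
    exact ⟨LinearEquiv.ofLinearMap h h' e1 e2, hT⟩

/-! ### Jordan blocks on nested intervals -/

/-- A finite family of intervals `[lo i, hi i)` of natural numbers, each nested strictly inside the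
next one. -/
structure NestedIntervals where
  /-- The number of intervals. -/
  num : ℕ
  /-- A bound for the end points. -/
  bound : ℕ
  /-- The left end points. -/
  lo : Fin num → ℕ
  /-- The right end points. -/
  hi : Fin num → ℕ
  lo_strictAnti : StrictAnti lo
  hi_strictMono : StrictMono hi
  hi_le : ∀ i, hi i ≤ bound

namespace NestedIntervals

variable (S : NestedIntervals)

/-- The points of the disjoint union of a family of intervals; they index a basis of a direct sum
of Jordan blocks. -/
abbrev Point : Type := {p : Fin S.num × Fin S.bound // S.lo p.1 ≤ p.2 ∧ (p.2 : ℕ) < S.hi p.1}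

variable {S}

/-- The index of the interval that contains a point. -/
def Point.block (p : S.Point) : Fin S.num := p.1.1

/-- The position of a point in its interval. -/
def Point.deg (p : S.Point) : ℕ := p.1.2

theorem Point.lo_le (p : S.Point) : S.lo p.block ≤ p.deg := p.2.1

theorem Point.lt_hi (p : S.Point) : p.deg < S.hi p.block := p.2.2

theorem Point.deg_lt (p : S.Point) : p.deg < S.bound := p.1.2.2

theorem Point.eq_of {p q : S.Point} (h : p.block = q.block) (h' : p.deg = q.deg) : p = q :=
  Subtype.ext (Prod.ext h (Fin.ext h'))

/-- The point `p` is the successor of the point `q` in the same interval. -/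
def Point.IsSucc (p q : S.Point) : Prop := p.block = q.block ∧ p.deg = q.deg + 1

instance (p q : S.Point) : Decidable (p.IsSucc q) := by unfold Point.IsSucc; infer_instance

theorem Point.exists_mk (i : Fin S.num) (d : ℕ) (h : S.lo i ≤ d) (h' : d < S.hi i) :
    ∃ p : S.Point, p.block = i ∧ p.deg = d :=
  ⟨⟨(i, ⟨d, h'.trans_le (S.hi_le i)⟩), h, h'⟩, rfl, rfl⟩

theorem Point.IsSucc.left_unique {p p' q : S.Point} (h : p.IsSucc q) (h' : p'.IsSucc q) : p = p' :=
  Point.eq_of (h.1.trans h'.1.symm) (h.2.trans h'.2.symm)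

theorem Point.IsSucc.right_unique {p q q' : S.Point} (h : p.IsSucc q) (h' : p.IsSucc q') :
    q = q' :=
  Point.eq_of (h.1.symm.trans h'.1) (Nat.succ_injective (h.2.symm.trans h'.2))

theorem Point.exists_succ (q : S.Point) (h : q.deg + 1 < S.hi q.block) :
    ∃ p : S.Point, p.IsSucc q :=
  Point.exists_mk q.block (q.deg + 1) (q.lo_le.trans (Nat.le_succ _)) h

theorem Point.exists_pred (p : S.Point) (h : S.lo p.block < p.deg) :
    ∃ q : S.Point, p.IsSucc q := by
  obtain ⟨q, h1, h2⟩ := Point.exists_mk p.block (p.deg - 1) (by omega)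
    (lt_of_le_of_lt (Nat.sub_le _ _) p.lt_hi)
  exact ⟨q, h1.symm, by omega⟩

variable (S) in
/-- The nilpotent matrix that shifts each of the intervals. -/
def shift (A : Type*) [Semiring A] : Matrix S.Point S.Point A :=
  Matrix.of fun p q => if p.IsSucc q then 1 else 0

section Sums

variable {K : Type*} [Field K] {A : Type*} [Ring A] [Algebra K A] {V V' : Type*}
  [AddCommGroup V] [Module K V] [AddCommGroup V'] [Module K V'] {β : Type*}

theorem sum_comp_shift (τ : A →ₐ[K] Module.End K V) (G : S.Point → V →ₗ[K] V') {p q : S.Point}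
    (h : p.IsSucc q) : ∑ k, G k ∘ₗ τ (S.shift A k q) = G p := by
  rw [Finset.sum_eq_single p]
  · simp only [shift, Matrix.of_apply, if_pos h, map_one]
    rfl
  · intro k _ hk
    have : ¬ k.IsSucc q := fun h' => hk (h'.left_unique h)
    simp [shift, this]
  · simp

theorem sum_comp_shift_eq_zero (τ : A →ₐ[K] Module.End K V) (G : S.Point → V →ₗ[K] V')
    {q : S.Point} (h : ∀ p : S.Point, ¬ p.IsSucc q) :
    ∑ k, G k ∘ₗ τ (S.shift A k q) = 0 :=
  Finset.sum_eq_zero fun k _ => by simp [shift, h k]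

theorem sum_shift_comp (τ : A →ₐ[K] Module.End K V') (G : S.Point → V →ₗ[K] V') {p q : S.Point}
    (h : p.IsSucc q) : ∑ k, τ (S.shift A p k) ∘ₗ G k = G q := by
  rw [Finset.sum_eq_single q]
  · simp only [shift, Matrix.of_apply, if_pos h, map_one]
    rfl
  · intro k _ hk
    have : ¬ p.IsSucc k := fun h' => hk (h'.right_unique h)
    simp [shift, this]
  · simp

theorem sum_shift_comp_eq_zero (τ : A →ₐ[K] Module.End K V') (G : S.Point → V →ₗ[K] V')
    {p : S.Point} (h : ∀ q : S.Point, ¬ p.IsSucc q) :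
    ∑ k, τ (S.shift A p k) ∘ₗ G k = 0 :=
  Finset.sum_eq_zero fun k _ => by simp [shift, h k]

end Sums

section Commute

variable {K : Type*} [Field K] {A : Type*} [Ring A] [Algebra K A] {V V' : Type*}
  [AddCommGroup V] [Module K V] [AddCommGroup V'] [Module K V']
  (τ : A →ₐ[K] Module.End K V) (τ' : A →ₐ[K] Module.End K V')

/-- A family of blocks whose shifts on the two sides differ by the family itself vanishes. -/
theorem eq_zero_of_shift_sub {S' : NestedIntervals} (G : S'.Point → S.Point → V →ₗ[K] V') (c : K)
    (hc : c ≠ 0)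
    (h : ∀ p q, c • G p q = ∑ k, G p k ∘ₗ τ (S.shift A k q) - ∑ k, τ' (S'.shift A p k) ∘ₗ G k q)
    (p : S'.Point) (q : S.Point) : G p q = 0 := by
  -- Both shifts lower this measure: one replaces `q` by its successor, the other `p` by its
  -- predecessor.
  have key : ∀ (d : ℕ) (p : S'.Point) (q : S.Point), p.deg + (S.bound - q.deg) ≤ d →
      G p q = 0 := by
    intro d
    induction d with
    | zero =>
      intro p q hd
      have := q.deg_lt
      omega
    | succ d ih =>
      intro p q hd
      have h1 : ∑ k, G p k ∘ₗ τ (S.shift A k q) = 0 := by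
        by_cases hq : ∃ q' : S.Point, q'.IsSucc q
        · obtain ⟨q', hq'⟩ := hq
          rw [sum_comp_shift τ _ hq']
          have h2 := hq'.2
          have h3 := q'.deg_lt
          exact ih p q' (by omega)
        · exact sum_comp_shift_eq_zero τ _ (not_exists.1 hq)
      have h2 : ∑ k, τ' (S'.shift A p k) ∘ₗ G k q = 0 := by
        by_cases hp : ∃ p' : S'.Point, p.IsSucc p'
        · obtain ⟨p', hp'⟩ := hp
          rw [sum_shift_comp τ' (fun k => G k q) hp']
          have h2 := hp'.2
          exact ih p' q (by omega)
        · exact sum_shift_comp_eq_zero τ' (fun k => G k q) (not_exists.1 hp)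
      have h3 := h p q
      rw [h1, h2, sub_zero] at h3
      exact (smul_eq_zero.1 h3).resolve_left hc
  exact key _ p q le_rfl

variable {F : S.Point → S.Point → V →ₗ[K] V'}
  (hF : ∀ p q, ∑ k, F p k ∘ₗ τ (S.shift A k q) = ∑ k, τ' (S.shift A p k) ∘ₗ F k q)
include hF

/-- Commutation evaluated at `(p', q)`: the blocks are constant along each diagonal of a pair of
intervals. -/
theorem eq_of_isSucc {p p' q q' : S.Point} (hp : p'.IsSucc p) (hq : q'.IsSucc q) :
    F p' q' = F p q := by
  have := hF p' q
  rwa [sum_comp_shift τ _ hq, sum_shift_comp τ' (fun k => F k q) hp] at this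

/-- Move `p` and `q` down together. The point `p` reaches the bottom of its interval first, where
the row of the shift is zero. -/
theorem eq_zero_of_lo (d : ℕ) (p q : S.Point) (hd : p.deg - S.lo p.block = d)
    (h : p.deg + S.lo q.block < q.deg + S.lo p.block) : F p q = 0 := by
  have := p.lo_le
  have := q.lo_le
  obtain ⟨q', hq'⟩ := q.exists_pred (by omega)
  have hq1 := hq'.1
  have hq2 := hq'.2
  induction d generalizing p q q' with
  | zero =>
    have h1 := hF p q'
    rw [sum_comp_shift τ _ hq', sum_shift_comp_eq_zero τ' (fun k => F k q')] at h1
    · exact h1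
    · intro k hk
      have h2 := k.lo_le
      have h3 := hk.1
      have h4 := hk.2
      rw [← h3] at h2
      omega
  | succ d ih =>
    obtain ⟨p', hp'⟩ := p.exists_pred (by omega)
    have h3 := hp'.1
    have h4 := hp'.2
    rw [eq_of_isSucc τ τ' hF hp' hq']
    have h5 : p'.deg - S.lo p'.block = d := by rw [← h3]; omega
    have h6 : p'.deg + S.lo q'.block < q'.deg + S.lo p'.block := by rw [← h3, ← hq1]; omega
    have h7 := p'.lo_le
    have h8 := q'.lo_le
    obtain ⟨q'', hq''⟩ := q'.exists_pred (by omega)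
    exact ih p' q' h5 h6 h7 h8 q'' hq'' hq''.1 hq''.2

/-- Move `p` and `q` up together. The point `q` reaches the top of its interval first, where the
column of the shift is zero. -/
theorem eq_zero_of_hi (d : ℕ) (p q : S.Point) (hd : S.hi q.block - q.deg = d)
    (h : q.deg + S.hi p.block > p.deg + S.hi q.block) : F p q = 0 := by
  have := p.lt_hi
  have := q.lt_hi
  obtain ⟨p', hp'⟩ := p.exists_succ (by omega)
  have hp1 := hp'.1
  have hp2 := hp'.2
  induction d generalizing p q p' with
  | zero => omega
  | succ d ih =>
    by_cases hq : ∃ q' : S.Point, q'.IsSucc q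
    · obtain ⟨q', hq'⟩ := hq
      have h3 := hq'.1
      have h4 := hq'.2
      rw [← eq_of_isSucc τ τ' hF hp' hq']
      have h5 : S.hi q'.block - q'.deg = d := by rw [h3]; omega
      have h6 : q'.deg + S.hi p'.block > p'.deg + S.hi q'.block := by rw [h3, hp1]; omega
      have h7 := p'.lt_hi
      have h8 := q'.lt_hi
      obtain ⟨p'', hp''⟩ := p'.exists_succ (by omega)
      exact ih p' q' h5 h6 h7 h8 p'' hp'' hp''.1 hp''.2
    · have h1 := hF p' q
      rw [sum_comp_shift_eq_zero τ _ (not_exists.1 hq),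
        sum_shift_comp τ' (fun k => F k q) hp'] at h1
      exact h1.symm

/-- A family of blocks that commutes with the shift of nested intervals vanishes outside the
diagonal in nonpositive degrees. -/
theorem eq_zero_of_commute {p q : S.Point} (hpq : p ≠ q) (h : p.deg ≤ q.deg) : F p q = 0 := by
  -- If `p` lies in the inner interval its left end is higher, if in the outer one its right end is
  -- higher; either obstructs a map of degree at most 0.
  rcases lt_trichotomy p.block q.block with hb | hb | hb
  · have := S.lo_strictAnti hb
    exact eq_zero_of_lo τ τ' hF _ p q rfl (by omega)
  · have hd : p.deg ≠ q.deg := fun hd => hpq (Point.eq_of hb hd)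
    exact eq_zero_of_lo τ τ' hF _ p q rfl (by rw [hb]; omega)
  · have := S.hi_strictMono hb
    exact eq_zero_of_hi τ τ' hF _ p q rfl (by omega)

/-- A family of blocks that commutes with the shift has constant diagonal on each interval. -/
theorem diag_eq_of_block_eq {p q : S.Point} (h : p.block = q.block) : F p p = F q q := by
  wlog hle : p.deg ≤ q.deg generalizing p q
  · exact (this h.symm (le_of_not_ge hle)).symm
  obtain ⟨d, hd⟩ := Nat.exists_eq_add_of_le hle
  induction d generalizing q with
  | zero => rw [Point.eq_of h hd.symm]
  | succ d ih =>
    have h1 := p.lo_le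
    rw [h] at h1
    obtain ⟨q', hq'⟩ := q.exists_pred (by omega)
    have h2 := hq'.2
    rw [eq_of_isSucc τ τ' hF hq' hq']
    exact ih (h.trans hq'.1) (by omega) (by omega)

end Commute

end NestedIntervals

open NestedIntervals

/-! ### The five intervals and the linking matrix -/

/-- The intervals `[3, 6)` and `[2, 7)`. -/
def srcIntervals : NestedIntervals where
  num := 2
  bound := 7
  lo i := 3 - i
  hi i := 6 + i
  lo_strictAnti i j h := by
    have := j.isLt
    have : (i : ℕ) < j := h
    simp only
    omega
  hi_strictMono i j h := by
    have : (i : ℕ) < j := h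
    simp only
    omega
  hi_le i := by omega

/-- The intervals `[2, 4)`, `[1, 5)` and `[0, 6)`. -/
def tgtIntervals : NestedIntervals where
  num := 3
  bound := 6
  lo i := 2 - i
  hi i := 4 + i
  lo_strictAnti i j h := by
    have := j.isLt
    have : (i : ℕ) < j := h
    simp only
    omega
  hi_strictMono i j h := by
    have : (i : ℕ) < j := h
    simp only
    omega
  hi_le i := by omega

theorem two_le_deg_src (q : srcIntervals.Point) : 2 ≤ q.deg := by
  have h : 3 - (q.block : ℕ) ≤ q.deg := q.lo_le
  have : (q.block : ℕ) < 2 := q.block.2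
  omega

theorem exists_src (i : Fin 2) (d : ℕ) (h : 3 ≤ d) (h' : d < 6) :
    ∃ q : srcIntervals.Point, q.block = i ∧ q.deg = d :=
  Point.exists_mk (S := srcIntervals) i d (show 3 - (i : ℕ) ≤ d by omega)
    (show d < 6 + (i : ℕ) by omega)

theorem exists_tgt (j : Fin 3) (d : ℕ) (h : 2 ≤ d) (h' : d < 4) :
    ∃ p : tgtIntervals.Point, p.block = j ∧ p.deg = d :=
  Point.exists_mk (S := tgtIntervals) j d (show 2 - (j : ℕ) ≤ d by omega)
    (show d < 4 + (j : ℕ) by omega)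

section Link

variable (K : Type*) [Field K]

/-- A pair of operators as a representation of the complete bipartite quiver with two sources and
three sinks. -/
def coeff : Fin 3 → Fin 2 → FreeAlgebra K (Fin 2) :=
  ![![1, 1], ![1, FreeAlgebra.ι K 0], ![1, FreeAlgebra.ι K 1]]

/-- The matrix of the homomorphism of degree zero with the coefficients `coeff`. -/
def link : Matrix tgtIntervals.Point srcIntervals.Point (FreeAlgebra K (Fin 2)) :=
  Matrix.of fun p q => if p.deg = q.deg then coeff K p.block q.block else 0

/-- Every target interval starts and ends no later than every source interval, which is the
condition for a degree-zero map between Jordan blocks; hence all six coefficients may be chosen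
freely. -/
theorem link_mul_shift : link K * srcIntervals.shift (FreeAlgebra K (Fin 2)) =
    tgtIntervals.shift (FreeAlgebra K (Fin 2)) * link K := by
  ext p q
  rw [Matrix.mul_apply, Matrix.mul_apply]
  by_cases hd : p.deg = q.deg + 1
  · have hq2 := two_le_deg_src q
    obtain ⟨q', hq'⟩ := q.exists_succ (by
      have h1 := p.deg_lt
      have h2 : srcIntervals.hi q.block = 6 + (q.block : ℕ) := rfl
      have h3 : tgtIntervals.bound = 6 := rfl
      omega)
    obtain ⟨p', hp'⟩ := p.exists_pred (by
      have h2 : tgtIntervals.lo p.block = 2 - (p.block : ℕ) := rfl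
      omega)
    have e1 := hq'.1
    have e2 := hq'.2
    have e3 := hp'.1
    have e4 := hp'.2
    rw [Finset.sum_eq_single q', Finset.sum_eq_single p']
    · have e5 : p.deg = q'.deg := by omega
      have e6 : p'.deg = q.deg := by omega
      simp only [link, shift, Matrix.of_apply, if_pos hq', if_pos hp', if_pos e5, if_pos e6,
        mul_one, one_mul, e1, e3]
    · intro k _ hk
      have : ¬ p.IsSucc k := fun h' => hk (h'.right_unique hp')
      simp [shift, this]
    · simp
    · intro k _ hk
      have : ¬ k.IsSucc q := fun h' => hk (h'.left_unique hq')
      simp [shift, this]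
    · simp
  · rw [Finset.sum_eq_zero, Finset.sum_eq_zero]
    · intro k _
      by_cases h1 : p.IsSucc k
      · have h2 : k.deg ≠ q.deg := fun h => hd (h ▸ h1.2)
        simp [link, h2]
      · simp [shift, h1]
    · intro k _
      by_cases h1 : k.IsSucc q
      · have h2 : p.deg ≠ k.deg := fun h => hd (h.trans h1.2)
        simp [link, h2]
      · simp [shift, h1]

variable {K} {V V' : Type*} [AddCommGroup V] [Module K V] [AddCommGroup V'] [Module K V']

/-- Two families of blocks that commute with the shifts and with the linking matrix are triangular
with the same diagonal, which intertwines the given pairs of operators. -/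
theorem exists_isTriangular (T : Fin 2 → Module.End K V) (T' : Fin 2 → Module.End K V')
    {F : srcIntervals.Point → srcIntervals.Point → V →ₗ[K] V'}
    {G : tgtIntervals.Point → tgtIntervals.Point → V →ₗ[K] V'}
    (hF : ∀ p q, ∑ k, F p k ∘ₗ FreeAlgebra.lift K T (srcIntervals.shift _ k q) =
      ∑ k, FreeAlgebra.lift K T' (srcIntervals.shift _ p k) ∘ₗ F k q)
    (hG : ∀ p q, ∑ k, G p k ∘ₗ FreeAlgebra.lift K T (tgtIntervals.shift _ k q) =
      ∑ k, FreeAlgebra.lift K T' (tgtIntervals.shift _ p k) ∘ₗ G k q)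
    (hFG : ∀ p q, ∑ k, G p k ∘ₗ FreeAlgebra.lift K T (link K k q) =
      ∑ k, FreeAlgebra.lift K T' (link K p k) ∘ₗ F k q) :
    ∃ h : V →ₗ[K] V', (∀ s m, h (T s m) = T' s (h m)) ∧ IsTriangular Point.deg F h ∧
      IsTriangular Point.deg G h := by
  have hdiag : ∀ (p : tgtIntervals.Point) (q : srcIntervals.Point), p.deg = q.deg →
      G p p ∘ₗ FreeAlgebra.lift K T (coeff K p.block q.block) =
        FreeAlgebra.lift K T' (coeff K p.block q.block) ∘ₗ F q q := by
    intro p q hpq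
    have h := hFG p q
    rw [Finset.sum_eq_single p, Finset.sum_eq_single q] at h
    · simpa only [link, Matrix.of_apply, if_pos hpq] using h
    · intro k _ hk
      by_cases hd : p.deg = k.deg
      · rw [eq_zero_of_commute _ _ hF hk (by omega), LinearMap.comp_zero]
      · simp [link, hd]
    · simp
    · intro k _ hk
      by_cases hd : k.deg = q.deg
      · rw [eq_zero_of_commute _ _ hG hk.symm (by omega), LinearMap.zero_comp]
      · simp [link, hd]
    · simp
  -- Degree 3 is the only degree common to all five intervals, so there `hdiag` compares every
  -- source block with every target block.
  obtain ⟨q₀, hq₀, hq₀'⟩ := exists_src 0 3 (by omega) (by omega)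
  obtain ⟨q₁, hq₁, hq₁'⟩ := exists_src 1 3 (by omega) (by omega)
  -- The first column of `coeff` consists of ones, which identifies all target diagonals with that
  -- of source 0.
  have hGF : ∀ p, G p p = F q₀ q₀ := by
    intro p
    obtain ⟨p', hp', hd⟩ := exists_tgt p.block 3 (by omega) (by omega)
    have h := hdiag p' q₀ (hd.trans hq₀'.symm)
    have hc : coeff K p'.block q₀.block = 1 := by
      rw [hq₀]
      generalize p'.block = j
      change Fin 3 at j
      fin_cases j <;> rfl
    rw [hc, map_one, map_one] at h
    rw [← diag_eq_of_block_eq _ _ hG hp']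
    exact h
  -- The remaining 1 in row 0 identifies the two sources.
  have hF₁ : F q₁ q₁ = F q₀ q₀ := by
    obtain ⟨p, hp, hd⟩ := exists_tgt 0 3 (by omega) (by omega)
    have h := hdiag p q₁ (hd.trans hq₁'.symm)
    have hc : coeff K p.block q₁.block = 1 := by rw [hq₁, hp]; rfl
    rw [hc, map_one, map_one, hGF] at h
    exact h.symm
  refine ⟨F q₀ q₀, fun s m => ?_, ⟨fun q => ?_, fun i j hij hd => ?_⟩,
    ⟨hGF, fun i j hij hd => eq_zero_of_commute _ _ hG hij hd⟩⟩
  -- Row `s + 1` of the second column is the generator, so it yields the intertwining relation for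
  -- `T s`.
  · obtain ⟨p, hp, hd⟩ := exists_tgt s.succ 3 (by omega) (by omega)
    have h := hdiag p q₁ (hd.trans hq₁'.symm)
    have hc : coeff K p.block q₁.block = FreeAlgebra.ι K s := by
      rw [hq₁, hp]
      fin_cases s <;> rfl
    rw [hc, FreeAlgebra.lift_ι_apply, FreeAlgebra.lift_ι_apply, hGF, hF₁] at h
    exact LinearMap.congr_fun h m
  · have h : q.block = q₀.block ∨ q.block = q₁.block := by
      rw [hq₀, hq₁]
      generalize q.block = j
      change Fin 2 at j
      fin_cases j
      · exact Or.inl rfl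
      · exact Or.inr rfl
    rcases h with h | h
    · exact diag_eq_of_block_eq _ _ hF h
    · rw [diag_eq_of_block_eq _ _ hF h, hF₁]
  · exact eq_zero_of_commute _ _ hF hij hd

end Link

/-! ### The two-layer representation and its intertwiners -/

section Kronecker

variable {K : Type*} [Field K] {A : Type*} [Ring A] [Algebra K A]
  {l m n l' m' n' : Type*}

/-- The Kronecker product of a matrix of scalars and a matrix over an algebra. -/
def scalarKronecker : Matrix l m K →ₗ[K] Matrix l' m' A →ₗ[K] Matrix (l × l') (m × m') A :=
  Matrix.kroneckerMapBilinear (LinearMap.lsmul K A)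

theorem scalarKronecker_apply (M : Matrix l m K) (N : Matrix l' m' A) (i : l × l') (j : m × m') :
    scalarKronecker M N i j = M i.1 j.1 • N i.2 j.2 := rfl

theorem scalarKronecker_mul [Fintype m] [Fintype m'] (M : Matrix l m K) (M₁ : Matrix m n K)
    (N : Matrix l' m' A) (N₁ : Matrix m' n' A) :
    scalarKronecker M N * scalarKronecker M₁ N₁ = scalarKronecker (M * M₁) (N * N₁) :=
  (Matrix.kroneckerMapBilinear_mul_mul (LinearMap.lsmul K A)
    (fun a b a' b' => by simp [smul_smul, mul_comm]) M M₁ N N₁).symm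

end Kronecker

section BlockRep

variable {K : Type*} [Field K] {L : Type*} [LieRing L] [LieAlgebra K L] {d : Type*} [Fintype d]
  [DecidableEq d] {A : Type*} [Ring A] [Algebra K A] {P Q : Type*} [Fintype P] [Fintype Q]
  [DecidableEq P] [DecidableEq Q]

/-- The matrix representation of a Lie algebra with a character `c`, a representation `r` and a
cocycle `π`, that is given by a homomorphism `Φ` between modules with operators `N` and `N'`. -/
def blockRep (N : Matrix P P A) (N' : Matrix Q Q A) (Φ : Matrix Q P A) (hΦ : Φ * N = N' * Φ)
    (c : L →ₗ[K] K) (r : L →ₗ⁅K⁆ Matrix d d K) (π : L →ₗ[K] (d → K))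
    (hc : ∀ x y : L, c ⁅x, y⁆ = 0)
    (hπ : ∀ x y : L, π ⁅x, y⁆ = Matrix.mulVec (r x) (π y) - Matrix.mulVec (r y) (π x)) :
    L →ₗ⁅K⁆ Matrix ((Unit × P) ⊕ (d × Q)) ((Unit × P) ⊕ (d × Q)) A where
  toFun x := Matrix.fromBlocks (c x • scalarKronecker (1 : Matrix Unit Unit K) N) 0
    (scalarKronecker (Matrix.replicateCol Unit (π x)) Φ)
    (scalarKronecker (r x) (1 : Matrix Q Q A) + c x • scalarKronecker (1 : Matrix d d K) N')
  map_add' x y := by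
    have hcol : Matrix.replicateCol Unit (π (x + y)) =
        Matrix.replicateCol Unit (π x) + Matrix.replicateCol Unit (π y) := by
      rw [map_add]; rfl
    rw [hcol, map_add c, map_add r, Matrix.fromBlocks_add]
    simp only [add_smul, map_add, LinearMap.add_apply, add_zero]
    congr 1
    abel
  map_smul' t x := by
    have hcol : Matrix.replicateCol Unit (π (t • x)) = t • Matrix.replicateCol Unit (π x) := by
      rw [map_smul]; rfl
    rw [hcol, map_smul c, map_smul r, RingHom.id_apply, Matrix.fromBlocks_smul]
    simp only [smul_assoc, map_smul, LinearMap.smul_apply, smul_zero, smul_add]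
  map_lie' {x y} := by
    have hcol : Matrix.replicateCol Unit (π ⁅x, y⁆) =
        r x * Matrix.replicateCol Unit (π y) - r y * Matrix.replicateCol Unit (π x) := by
      rw [hπ]; rfl
    rw [hcol, hc, LieHom.map_lie, LieRing.of_associative_ring_bracket,
      LieRing.of_associative_ring_bracket, Matrix.fromBlocks_multiply, Matrix.fromBlocks_multiply,
      sub_eq_add_neg (Matrix.fromBlocks _ _ _ _), Matrix.fromBlocks_neg, Matrix.fromBlocks_add]
    -- In the lower left block the terms with `c x` and `c y` cancel because `Φ * N = N' * Φ`; the
    -- cocycle identity accounts for the rest.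
    simp only [Matrix.mul_add, Matrix.add_mul, scalarKronecker_mul, hΦ, Matrix.mul_one,
      Matrix.one_mul, Matrix.mul_zero, Matrix.zero_mul, Matrix.smul_mul, Matrix.mul_smul,
      map_sub, LinearMap.sub_apply, zero_smul, smul_add, add_zero, zero_add,
      smul_comm (c y) (c x)]
    congr 1
    · abel
    · simp
    · abel
    · abel

variable {N : Matrix P P A} {N' : Matrix Q Q A} {Φ : Matrix Q P A} {hΦ : Φ * N = N' * Φ}
  {c : L →ₗ[K] K} {r : L →ₗ⁅K⁆ Matrix d d K} {π : L →ₗ[K] (d → K)}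
  {hc : ∀ x y : L, c ⁅x, y⁆ = 0}
  {hπ : ∀ x y : L, π ⁅x, y⁆ = Matrix.mulVec (r x) (π y) - Matrix.mulVec (r y) (π x)}

theorem blockRep_inl_inl (x : L) (p q : P) (i j : Unit) :
    blockRep N N' Φ hΦ c r π hc hπ x (.inl (i, p)) (.inl (j, q)) = c x • N p q := by
  simp [blockRep, scalarKronecker_apply]

theorem blockRep_inl_inr (x : L) (p : Unit × P) (q : d × Q) :
    blockRep N N' Φ hΦ c r π hc hπ x (.inl p) (.inr q) = 0 := rfl

theorem blockRep_inr_inl (x : L) (a : d) (p : Q) (i : Unit) (q : P) :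
    blockRep N N' Φ hΦ c r π hc hπ x (.inr (a, p)) (.inl (i, q)) = π x a • Φ p q := rfl

theorem blockRep_inr_inr (x : L) (a b : d) (p q : Q) :
    blockRep N N' Φ hΦ c r π hc hπ x (.inr (a, p)) (.inr (b, q)) =
      (if p = q then r x a b • 1 else 0) + c x • (if a = b then N' p q else 0) := by
  simp [blockRep, scalarKronecker_apply, Matrix.one_apply]

variable {V V' : Type*} [AddCommGroup V] [Module K V] [AddCommGroup V'] [Module K V']
  {τ : A →ₐ[K] Module.End K V} {τ' : A →ₐ[K] Module.End K V'}
  {F : (Unit × P) ⊕ (d × Q) → (Unit × P) ⊕ (d × Q) → V →ₗ[K] V'}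
  (hF : ∀ x i j, ∑ k, F i k ∘ₗ τ (blockRep N N' Φ hΦ c r π hc hπ x k j) =
    ∑ k, τ' (blockRep N N' Φ hΦ c r π hc hπ x i k) ∘ₗ F k j)
  {e : L} (hce : c e = 1) (hre : r e = 1) (hπe : π e = 0)

theorem comp_map_ite (τ : A →ₐ[K] Module.End K V) (G : V →ₗ[K] V') (p : Prop) [Decidable p]
    (a : A) : G ∘ₗ τ (if p then a else 0) = if p then G ∘ₗ τ a else 0 := by
  split_ifs <;> simp

theorem map_ite_comp (τ : A →ₐ[K] Module.End K V') (G : V →ₗ[K] V') (p : Prop) [Decidable p]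
    (a : A) : τ (if p then a else 0) ∘ₗ G = if p then τ a ∘ₗ G else 0 := by
  split_ifs <;> simp

theorem comp_end_ite (G : V →ₗ[K] V') (p : Prop) [Decidable p] (f : Module.End K V) :
    G ∘ₗ (if p then f else 0) = if p then G ∘ₗ f else 0 := by
  split_ifs <;> simp

theorem end_ite_comp (G : V →ₗ[K] V') (p : Prop) [Decidable p] (f : Module.End K V') :
    (if p then f else 0) ∘ₗ G = if p then f ∘ₗ G else 0 := by
  split_ifs <;> simp

theorem comp_end_one (G : V →ₗ[K] V') : G ∘ₗ (1 : Module.End K V) = G := rfl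

theorem end_one_comp (G : V →ₗ[K] V') : (1 : Module.End K V') ∘ₗ G = G := rfl

include hF hce hre in
theorem block_inl_inr (p : P) (b : d) (q : Q) :
    F (.inl ((), p)) (.inr (b, q)) + ∑ k, F (.inl ((), p)) (.inr (b, k)) ∘ₗ τ (N' k q) =
      ∑ k, τ' (N p k) ∘ₗ F (.inl ((), k)) (.inr (b, q)) := by
  have h := hF e (.inl ((), p)) (.inr (b, q))
  simpa [Fintype.sum_sum_type, Fintype.sum_prod_type, blockRep_inl_inl, blockRep_inl_inr,
    blockRep_inr_inr, hce, hre, Matrix.one_apply, LinearMap.comp_add, comp_map_ite, comp_end_ite,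
    comp_end_one,
    Finset.sum_add_distrib] using h

include hF hce hre hπe in
theorem block_inr_inl (p : P) (b : d) (q : Q) :
    ∑ k, F (.inr (b, q)) (.inl ((), k)) ∘ₗ τ (N k p) =
      F (.inr (b, q)) (.inl ((), p)) + ∑ k, τ' (N' q k) ∘ₗ F (.inr (b, k)) (.inl ((), p)) := by
  have h := hF e (.inr (b, q)) (.inl ((), p))
  simpa [Fintype.sum_sum_type, Fintype.sum_prod_type, blockRep_inl_inl, blockRep_inr_inl,
    blockRep_inr_inr, hce, hre, hπe, Matrix.one_apply, LinearMap.add_comp, map_ite_comp,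
    end_ite_comp, end_one_comp, Finset.sum_add_distrib] using h

include hF hce in
theorem block_inl_inl (p q : P) (h01 : ∀ p q, F (.inl p) (.inr q) = 0) :
    ∑ k, F (.inl ((), p)) (.inl ((), k)) ∘ₗ τ (N k q) =
      ∑ k, τ' (N p k) ∘ₗ F (.inl ((), k)) (.inl ((), q)) := by
  have h := hF e (.inl ((), p)) (.inl ((), q))
  simpa [Fintype.sum_sum_type, Fintype.sum_prod_type, blockRep_inl_inl, blockRep_inl_inr, h01,
    hce] using h

include hF hce hre in
theorem block_inr_inr (a b : d) (p q : Q) (h01 : ∀ p q, F (.inl p) (.inr q) = 0) :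
    ∑ k, F (.inr (a, p)) (.inr (b, k)) ∘ₗ τ (N' k q) =
      ∑ k, τ' (N' p k) ∘ₗ F (.inr (a, k)) (.inr (b, q)) := by
  have h := hF e (.inr (a, p)) (.inr (b, q))
  simpa [Fintype.sum_sum_type, Fintype.sum_prod_type, blockRep_inl_inr, blockRep_inr_inr, hce, hre,
    Matrix.one_apply, LinearMap.comp_add, LinearMap.add_comp, comp_map_ite, comp_end_ite,
    comp_end_one,
    map_ite_comp, end_ite_comp, end_one_comp, Finset.sum_add_distrib, h01] using h

-- Elements of this kind act only through `r` on the second layer, so this is the commutation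
-- relation needed for Schur's lemma.
include hF in
theorem sum_smul_block (x : L) (hcx : c x = 0) (hπx : π x = 0) (a b : d) (p q : Q) :
    ∑ k, r x k b • F (.inr (a, p)) (.inr (k, q)) =
      ∑ k, r x a k • F (.inr (k, p)) (.inr (b, q)) := by
  have h := hF x (.inr (a, p)) (.inr (b, q))
  simpa [Fintype.sum_sum_type, Fintype.sum_prod_type, blockRep_inl_inr, blockRep_inr_inr,
    blockRep_inr_inl, hcx, hπx, LinearMap.comp_smul, LinearMap.smul_comp, comp_map_ite,
    comp_end_ite, comp_end_one, map_ite_comp, end_ite_comp, end_one_comp] using h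

-- Elements of this kind act only from the first layer to the second, which isolates the
-- compatibility with `Φ`.
include hF in
theorem sum_block_comp_link (x : L) (hcx : c x = 0) (hrx : r x = 0) (a : d) (p : Q) (q : P) :
    ∑ b, π x b • ∑ k, F (.inr (a, p)) (.inr (b, k)) ∘ₗ τ (Φ k q) =
      π x a • ∑ k, τ' (Φ p k) ∘ₗ F (.inl ((), k)) (.inl ((), q)) := by
  have h := hF x (.inr (a, p)) (.inl ((), q))
  simpa [Fintype.sum_sum_type, Fintype.sum_prod_type, blockRep_inl_inl, blockRep_inr_inr,
    blockRep_inr_inl, hcx, hrx, LinearMap.comp_smul, LinearMap.smul_comp, Finset.smul_sum] using h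

include hF in
/-- Schur's lemma for the blocks of an intertwiner. -/
theorem exists_block_eq [Nonempty d] (hschur : ∀ M : Matrix d d K,
      (∀ x, c x = 0 → π x = 0 → M * r x = r x * M) → ∃ t : K, M = t • 1) :
    ∃ G : Q → Q → V →ₗ[K] V', ∀ a b p q,
      F (.inr (a, p)) (.inr (b, q)) = if a = b then G p q else 0 := by
  obtain ⟨a₀⟩ := ‹Nonempty d›
  refine ⟨fun p q => F (.inr (a₀, p)) (.inr (a₀, q)), fun a b p q => ?_⟩
  ext v
  rw [← sub_eq_zero, ← Module.forall_dual_apply_eq_zero_iff K]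
  intro l
  -- Evaluating at `v` and pairing with a functional `l` turns the blocks into a scalar matrix
  -- problem; functionals separate points, so nothing is lost.
  obtain ⟨t, ht⟩ := hschur (Matrix.of fun i j => l (F (.inr (i, p)) (.inr (j, q)) v)) (by
    intro x hcx hπx
    ext i j
    have h := congrArg (fun f => l (f v)) (sum_smul_block hF x hcx hπx i j p q)
    simpa [Matrix.mul_apply, LinearMap.sum_apply, mul_comm] using h)
  have h1 : ∀ i j, l (F (.inr (i, p)) (.inr (j, q)) v) = if i = j then t else 0 := by
    intro i j
    have := congrFun (congrFun ht i) j
    simpa [Matrix.one_apply] using this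
  rw [map_sub, h1]
  split_ifs with hab
  · rw [h1, if_pos rfl, sub_self]
  · simp

end BlockRep

/-- A Lie algebra with a character `c`, a representation `r` with scalar centralizer, and a cocycle
`π` is wild, if it has an element that acts by the identity and the cocycle takes all values on
elements that act trivially. -/
theorem isWild_of_cocycle {K : Type u} [Field K] {L : Type v} [LieRing L] [LieAlgebra K L]
    {d : Type*} [Fintype d] [DecidableEq d] [Nonempty d] (c : L →ₗ[K] K)
    (r : L →ₗ⁅K⁆ Matrix d d K) (π : L →ₗ[K] (d → K)) (hc : ∀ x y : L, c ⁅x, y⁆ = 0)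
    (hπ : ∀ x y : L, π ⁅x, y⁆ = Matrix.mulVec (r x) (π y) - Matrix.mulVec (r y) (π x))
    (e : L) (hce : c e = 1) (hre : r e = 1) (hπe : π e = 0)
    (hsurj : ∀ u, ∃ x, c x = 0 ∧ r x = 0 ∧ π x = u)
    (hschur : ∀ M : Matrix d d K, (∀ x, c x = 0 → π x = 0 → M * r x = r x * M) →
      ∃ t : K, M = t • 1) :
    IsWild K L := by
  obtain ⟨q₀, -, -⟩ := exists_src 0 3 (by omega) (by omega)
  have : Nonempty ((Unit × srcIntervals.Point) ⊕ (d × tgtIntervals.Point)) := ⟨.inl ((), q₀)⟩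
  refine isWild_of_triangular (blockRep _ _ _ (link_mul_shift K) c r π hc hπ)
    (Sum.elim (fun p => p.2.deg) (fun p => p.2.deg)) ?_
  intro V V' _ _ _ _ T T' F hF
  have h01 : ∀ (p : Unit × srcIntervals.Point) (q : d × tgtIntervals.Point),
      F (.inl p) (.inr q) = 0 := by
    rintro ⟨_, p⟩ ⟨b, q⟩
    refine eq_zero_of_shift_sub (FreeAlgebra.lift K T) (FreeAlgebra.lift K T')
      (fun p q => F (.inl ((), p)) (.inr (b, q))) (-1) (by simp) (fun p q => ?_) p q
    rw [← block_inl_inr hF hce hre p b q, neg_one_smul]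
    abel
  have h10 : ∀ (q : d × tgtIntervals.Point) (p : Unit × srcIntervals.Point),
      F (.inr q) (.inl p) = 0 := by
    rintro ⟨b, q⟩ ⟨_, p⟩
    refine eq_zero_of_shift_sub (FreeAlgebra.lift K T) (FreeAlgebra.lift K T')
      (fun q p => F (.inr (b, q)) (.inl ((), p))) 1 (by simp) (fun q p => ?_) q p
    rw [block_inr_inl hF hce hre hπe p b q, one_smul]
    abel
  obtain ⟨G, hG⟩ := exists_block_eq hF hschur
  obtain ⟨a⟩ := ‹Nonempty d›
  have hG' : ∀ p q, F (.inr (a, p)) (.inr (a, q)) = G p q := fun p q => by rw [hG, if_pos rfl]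
  -- A basis vector as cocycle value collapses the sum over `b` to the single term `a`.
  obtain ⟨x, hcx, hrx, hπx⟩ := hsurj (Pi.single a 1)
  obtain ⟨h, hT, hF₀, hG₀⟩ := exists_isTriangular T T'
    (F := fun p q => F (.inl ((), p)) (.inl ((), q))) (G := G)
    (fun p q => block_inl_inl hF hce p q h01)
    (fun p q => by simpa only [hG'] using block_inr_inr hF hce hre a a p q h01)
    (fun p q => by
      have h := sum_block_comp_link hF x hcx hrx a p q
      rw [hπx, Finset.sum_eq_single a] at h
      · simpa only [hG', Pi.single_eq_same, one_smul] using h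
      · intro b _ hb
        rw [Pi.single_eq_of_ne hb, zero_smul]
      · simp)
  refine ⟨h, hT, ?_, ?_⟩
  · rintro (⟨_, p⟩ | ⟨b, p⟩)
    · exact hF₀.1 p
    · rw [hG, if_pos rfl]
      exact hG₀.1 p
  · rintro (⟨_, p⟩ | ⟨b, p⟩) (⟨_, q⟩ | ⟨b', q⟩) hne hdeg
    · exact hF₀.2 p q (fun h => hne (by rw [h])) hdeg
    · exact h01 _ _
    · exact h10 _ _
    · rw [hG]
      split_ifs with hb
      · exact hG₀.2 p q (fun h => hne (by rw [h, hb])) hdeg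
      · rfl

/-! ### The data of the semidirect product -/

section Lie

variable {K : Type*} [Field K] {L : Type*} [LieRing L] [LieAlgebra K L]

/-- Schur's lemma over an algebraically closed field. -/
theorem exists_eq_smul_one_of_isIrreducible [IsAlgClosed K] {M : Type*} [AddCommGroup M]
    [Module K M] [FiniteDimensional K M] [LieRingModule L M] [LieModule K L M]
    [LieModule.IsIrreducible K L M] (f : Module.End K M)
    (hf : ∀ (x : L) (m : M), f ⁅x, m⁆ = ⁅x, f m⁆) : ∃ t : K, f = t • 1 := by
  have := LieModule.nontrivial_of_isIrreducible K L M
  obtain ⟨t, ht⟩ := Module.End.exists_eigenvalue f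
  let N : LieSubmodule K L M :=
    { f.eigenspace t with
      lie_mem := fun {x m} hm => by
        have hm' : f m = t • m := Module.End.mem_eigenspace_iff.1 hm
        exact Module.End.mem_eigenspace_iff.2 (by rw [hf, hm', lie_smul]) }
  have hN : N = ⊤ := (eq_bot_or_eq_top N).resolve_left fun h => ht (by
    rw [← LieSubmodule.toSubmodule_eq_bot] at h
    exact h)
  refine ⟨t, LinearMap.ext fun m => ?_⟩
  have hm : m ∈ N := hN ▸ LieSubmodule.mem_top m
  exact Module.End.mem_eigenspace_iff.1 hm

/-- The projections of a semidirect product to its factors. -/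
theorem exists_projections (L₀ I : LieSubalgebra K L) (J : LieIdeal K L)
    (hsum : DirectSum.IsInternal ![L₀.toSubmodule, I.toSubmodule, J.toSubmodule]) :
    (∀ x : L, ∃ l ∈ L₀, ∃ i ∈ I, ∃ j ∈ J, x = l + i + j) ∧
    (∃ pI : L →ₗ[K] I, (∀ l ∈ L₀, pI l = 0) ∧ (∀ i : I, pI i = i) ∧ ∀ j ∈ J, pI j = 0) ∧
    ∃ pJ : L →ₗ[K] J, (∀ l ∈ L₀, pJ l = 0) ∧ (∀ i ∈ I, pJ i = 0) ∧ ∀ j : J, pJ j = j := by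
  set A := ![L₀.toSubmodule, I.toSubmodule, J.toSubmodule] with hA
  obtain ⟨hind, htop⟩ := (DirectSum.isInternal_submodule_iff_iSupIndep_and_iSup_eq_top _).1 hsum
  have hcompl : ∀ k, IsCompl (A k) (⨆ j, ⨆ _ : j ≠ k, A j) := fun k =>
    ⟨hind k, codisjoint_iff.2 ((iSup_split_single A k).symm.trans htop)⟩
  have hle : ∀ j k, j ≠ k → A j ≤ ⨆ j, ⨆ _ : j ≠ k, A j := fun j k hjk =>
    le_iSup₂_of_le j hjk le_rfl
  refine ⟨fun x => ?_, ⟨Submodule.projectionOnto _ _ (hcompl 1), ?_, ?_, ?_⟩,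
    ⟨Submodule.projectionOnto _ _ (hcompl 2), ?_, ?_, ?_⟩⟩
  · have hsup : (⨆ k, A k) ≤ A 0 ⊔ A 1 ⊔ A 2 := iSup_le fun k => by
      fin_cases k
      · exact le_sup_left.trans le_sup_left
      · exact le_sup_right.trans le_sup_left
      · exact le_sup_right
    obtain ⟨y, hy, j, hj, rfl⟩ := Submodule.mem_sup.1
      (hsup (htop ▸ Submodule.mem_top : x ∈ ⨆ k, A k))
    obtain ⟨l, hl, i, hi, rfl⟩ := Submodule.mem_sup.1 hy
    exact ⟨l, hl, i, hi, j, hj, rfl⟩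
  · exact fun l hl => (Submodule.projectionOnto_apply_eq_zero_iff (hcompl 1)).2
      (hle 0 1 (by decide) hl)
  · exact fun i => Submodule.projectionOnto_apply_left (hcompl 1) i
  · exact fun j hj => (Submodule.projectionOnto_apply_eq_zero_iff (hcompl 1)).2
      (hle 2 1 (by decide) hj)
  · exact fun l hl => (Submodule.projectionOnto_apply_eq_zero_iff (hcompl 2)).2
      (hle 0 2 (by decide) hl)
  · exact fun i hi => (Submodule.projectionOnto_apply_eq_zero_iff (hcompl 2)).2
      (hle 1 2 (by decide) hi)
  · exact fun j => Submodule.projectionOnto_apply_left (hcompl 2) j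

/-- A semidirect product of commuting subalgebras `L₀`, `I`, where `I` is one-dimensional and
contains an element that acts as the identity, with an abelian ideal that is irreducible over `L₀`,
is wild. -/
theorem isWild_of_semidirect [IsAlgClosed K] [FiniteDimensional K L]
    (L₀ I : LieSubalgebra K L) (J : LieIdeal K L)
    (hsum : DirectSum.IsInternal ![L₀.toSubmodule, I.toSubmodule, J.toSubmodule])
    (hcomm : ∀ x ∈ L₀, ∀ y ∈ I, ⁅x, y⁆ = 0)
    (hJ : IsLieAbelian J)
    (hI : Module.finrank K I = 1)
    (hirr : LieModule.IsIrreducible K L₀ J)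
    (hid : ∃ e ∈ I, ∀ j ∈ J, ⁅e, j⁆ = j) :
    IsWild K L := by
  classical
  obtain ⟨hdec, ⟨pI, pI_L₀, pI_I, pI_J⟩, ⟨pJ, pJ_L₀, pJ_I, pJ_J⟩⟩ :=
    exists_projections L₀ I J hsum
  obtain ⟨e, he, heJ⟩ := hid
  have hnt : Nontrivial J := LieModule.nontrivial_of_isIrreducible K L₀ J
  have he0 : e ≠ 0 := by
    rintro rfl
    obtain ⟨j, hj⟩ := exists_ne (0 : J)
    have := heJ j j.2
    rw [zero_lie] at this
    exact hj (Subtype.ext this.symm)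
  obtain ⟨φ, hφe, hφ⟩ : ∃ φ : I →ₗ[K] K, φ ⟨e, he⟩ = 1 ∧ ∀ i : I, (i : L) = φ i • e := by
    have ψ : I ≃ₗ[K] K := LinearEquiv.ofFinrankEq I K (by rw [hI, Module.finrank_self])
    have hψ : ψ ⟨e, he⟩ ≠ 0 := fun h =>
      he0 (congrArg Subtype.val ((map_eq_zero_iff ψ ψ.injective).1 h))
    refine ⟨(ψ ⟨e, he⟩)⁻¹ • ψ.toLinearMap, by simp [hψ], fun i => ?_⟩
    refine congrArg Subtype.val (ψ.injective ?_ : i = ((ψ ⟨e, he⟩)⁻¹ • ψ.toLinearMap) i • ⟨e, he⟩)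
    simp only [LinearMap.smul_apply, LinearEquiv.coe_coe, map_smul, smul_eq_mul]
    field_simp
  have hII : ∀ i ∈ I, ∀ i' ∈ I, ⁅i, i'⁆ = 0 := by
    intro i hi i' hi'
    rw [show i = _ from hφ ⟨i, hi⟩, show i' = _ from hφ ⟨i', hi'⟩]
    simp
  have hJJ : ∀ j ∈ J, ∀ j' ∈ J, ⁅j, j'⁆ = 0 := fun j hj j' hj' =>
    congrArg Subtype.val (hJ.trivial ⟨j, hj⟩ ⟨j', hj'⟩)
  have hJr : ∀ j ∈ J, ∀ x, ⁅j, x⁆ ∈ J := fun j hj x => by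
    rw [← lie_skew]
    exact J.neg_mem (J.lie_mem hj)
  -- The `I`-component of a bracket vanishes and its `J`-component is the difference of the two
  -- actions: this makes `pI` give a character and `pJ` a cocycle.
  have hbr : ∀ l ∈ L₀, ∀ i ∈ I, ∀ j ∈ J, ∀ l' ∈ L₀, ∀ i' ∈ I, ∀ j' ∈ J,
      ⁅l + i + j, l' + i' + j'⁆ = ⁅l, l'⁆ + (⁅l + i + j, j'⁆ - ⁅l' + i' + j', j⁆) := by
    intro l hl i hi j hj l' hl' i' hi' j' hj'
    have h1 : ⁅i, l'⁆ = 0 := by rw [← lie_skew, hcomm l' hl' i hi, neg_zero]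
    simp only [add_lie, lie_add, hcomm l hl i' hi', h1, hII i hi i' hi', hJJ j hj j' hj',
      hJJ j' hj' j hj]
    rw [← lie_skew l' j, ← lie_skew i' j]
    abel
  have hpJ : ∀ x y : L, pJ ⁅x, y⁆ = ⁅x, pJ y⁆ - ⁅y, pJ x⁆ := by
    intro x y
    obtain ⟨l, hl, i, hi, j, hj, rfl⟩ := hdec x
    obtain ⟨l', hl', i', hi', j', hj', rfl⟩ := hdec y
    have h1 : pJ (l + i + j) = ⟨j, hj⟩ := by
      rw [map_add, map_add, pJ_L₀ l hl, pJ_I i hi, zero_add, zero_add]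
      exact pJ_J ⟨j, hj⟩
    have h2 : pJ (l' + i' + j') = ⟨j', hj'⟩ := by
      rw [map_add, map_add, pJ_L₀ l' hl', pJ_I i' hi', zero_add, zero_add]
      exact pJ_J ⟨j', hj'⟩
    rw [hbr l hl i hi j hj l' hl' i' hi' j' hj', map_add, pJ_L₀ _ (L₀.lie_mem hl hl'), zero_add,
      h1, h2]
    exact pJ_J (⁅l + i + j, (⟨j', hj'⟩ : J)⁆ - ⁅l' + i' + j', (⟨j, hj⟩ : J)⁆)
  have hpI : ∀ x y : L, pI ⁅x, y⁆ = 0 := by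
    intro x y
    obtain ⟨l, hl, i, hi, j, hj, rfl⟩ := hdec x
    obtain ⟨l', hl', i', hi', j', hj', rfl⟩ := hdec y
    rw [hbr l hl i hi j hj l' hl' i' hi' j' hj', map_add, pI_L₀ _ (L₀.lie_mem hl hl'), zero_add]
    exact pI_J _ (J.sub_mem (J.lie_mem hj') (J.lie_mem hj))
  let b := Module.finBasis K J
  have hd : Nonempty (Fin (Module.finrank K J)) := b.index_nonempty
  let r : L →ₗ⁅K⁆ Matrix (Fin (Module.finrank K J)) (Fin (Module.finrank K J)) K :=
    AlgHom.toLieHom (LinearMap.toMatrixAlgEquiv b).toAlgHom |>.comp (LieModule.toEnd K L J)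
  have hr : ∀ x, r x = LinearMap.toMatrix b b (LieModule.toEnd K L J x) := fun _ => rfl
  have hJ0 : ∀ j ∈ J, r j = 0 := fun j hj => by
    rw [hr, show LieModule.toEnd K L J j = 0 from
      LinearMap.ext fun j' => Subtype.ext (hJJ j hj j' j'.2), map_zero]
  refine isWild_of_cocycle (φ ∘ₗ pI) r (b.equivFun.toLinearMap ∘ₗ pJ) (fun x y => ?_)
    (fun x y => ?_) e ?_ ?_ ?_ (fun u => ?_) (fun M hM => ?_)
  · simp [hpI]
  · have hmul : ∀ (x : L) (j : J), Matrix.mulVec (r x) (b.equivFun j) = b.equivFun ⁅x, j⁆ :=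
      fun x j => LinearMap.toMatrix_mulVec_repr b b _ j
    simp only [LinearMap.comp_apply, LinearEquiv.coe_coe, hmul, hpJ, map_sub]
  · rw [LinearMap.comp_apply, pI_I ⟨e, he⟩, hφe]
  · rw [hr, show LieModule.toEnd K L J e = LinearMap.id from
      LinearMap.ext fun j => Subtype.ext (heJ j j.2), LinearMap.toMatrix_id]
  · rw [LinearMap.comp_apply, pJ_I e he, map_zero]
  · refine ⟨b.equivFun.symm u, ?_, hJ0 _ (Subtype.prop _), ?_⟩
    · rw [LinearMap.comp_apply, pI_J _ (Subtype.prop _), map_zero]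
    · rw [LinearMap.comp_apply, pJ_J]
      exact b.equivFun.apply_symm_apply u
  -- Elements of `L₀` are killed by both `pI` and `pJ`, so `M` commutes with the irreducible action
  -- of `L₀` on `J`.
  · obtain ⟨t, ht⟩ := exists_eq_smul_one_of_isIrreducible (L := L₀)
      (Matrix.toLin b b M) (fun x m => by
        have h := hM x (by rw [LinearMap.comp_apply, pI_L₀ x x.2, map_zero])
          (by rw [LinearMap.comp_apply, pJ_L₀ x x.2, map_zero])
        have h' := congrArg (Matrix.toLin b b) h
        rw [Matrix.toLin_mul b b b, Matrix.toLin_mul b b b, hr, Matrix.toLin_toMatrix] at h'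
        exact LinearMap.congr_fun h' m)
    refine ⟨t, ?_⟩
    rw [← LinearMap.toMatrix_toLin b b M, ht, map_smul]
    exact congrArg _ (LinearMap.toMatrix_id b)

end Lie

end LieWild

theorem mainTheorem4 {K : Type*} [Field K] [IsAlgClosed K] [CharZero K]
    {L : Type*} [LieRing L] [LieAlgebra K L] [FiniteDimensional K L]
    -- `L = (L₀ ⊕ I) ⋉ J` : commuting subalgebras `L₀`, `I` and an abelian ideal `J`
    (L₀ I : LieSubalgebra K L) (J : LieIdeal K L)
    (hsum : DirectSum.IsInternal ![L₀.toSubmodule, I.toSubmodule, J.toSubmodule])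
    (hcomm : ∀ x ∈ L₀, ∀ y ∈ I, ⁅x, y⁆ = 0)
    (hJ : IsLieAbelian J)
    (hL₀ : LieAlgebra.IsSemisimple K L₀)
    (hI : Module.finrank K I = 1)
    (hirr : LieModule.IsIrreducible K L₀ J)
    (hid : ∃ e ∈ I, ∀ j ∈ J, ⁅e, j⁆ = j) :
    LieWild.IsWild K L :=
  LieWild.isWild_of_semidirect L₀ I J hsum hcomm hJ hI hirr hid
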